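/- Let $k$ be a field. Algebras are associative $k$-algebras, possibly without a unity element, and $r(\Lambda)$ denotes the Jacobson radical of $\Lambda$, i.e. the largest left ideal all of whose elements are left quasi-regular ($y$ is left quasi-regular if $z+y+zy=0$ for some $z$). An algebra $\Lambda$ is a *generalized elementary algebra* if $\Lambda/r(\Lambda)\cong\bigoplus_{i\in I}k$ as algebras for some non-empty set $I$. It *can be lifted* if there is a subalgebra $A$ with $\Lambda=A\oplus r(\Lambda)$ as vector spaces. A *complete set of pairwise orthogonal idempotents* of $\Lambda$ is a family $\{e_i\}_{i\in I}$ of non-zero elements, $I\neq\emptyset$, with $e_ie_j=\delta_{ij}e_i$ for all $i,j\in I$ and such that for every $x\in\Lambda$ there is a finite $F\subseteq I$ with $(\sum_{i\in F}e_i)x=x(\sum_{i\in F}e_i)=x$. For a directed graph $D$ (possibly infinite, with loops and multiple arrows allowed) with non-empty vertex set, $kD$ is the path algebra: the $k$-vector space with basis all paths in $D$, including the paths of length $0$, with product given by concatenation where it is defined and $0$ otherwise. Let $J$ be the ideal of $kD$ generated by all arrows. A *path algebra with relations* is a quotient $kD/(\rho)$, where $\rho$ is a non-empty subset of $kD$ such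 that the two-sided ideal $(\rho)$ generated by $\rho$ satisfies $J^t\subseteq(\rho)\subseteq J^2$ for some integer $t\ge 1$. **Corollary 3.14.** For every algebra $\Lambda$ over $k$, the following are equivalent: 1. $\Lambda$ is a generalized elementary algebra, $\Lambda$ can be lifted, $r(\Lambda)$ is nilpotent, and $\Lambda$ has a complete set of pairwise orthogonal idempotents; 2. $\Lambda$ is isomorphic, as a $k$-algebra, to a path algebra with relations. -/

import Mathlib

/-!
Algebras over a field `k` are associative and need not have a unity element: an algebra is a type
`Λ` with `[NonUnitalRing Λ] [Module k Λ] [IsScalarTower k Λ Λ] [SMulCommClass k Λ Λ]`.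
-/

universe u v

section Ideals

variable (k : Type v) (Λ : Type u) [Field k] [NonUnitalRing Λ] [Module k Λ]

/-- A two-sided ideal of a (not necessarily unital) `k`-algebra. -/
structure AlgIdeal extends Submodule k Λ where
  mul_mem_left : ∀ a x : Λ, x ∈ carrier → a * x ∈ carrier
  mul_mem_right : ∀ x a : Λ, x ∈ carrier → x * a ∈ carrier

variable {k Λ}

/-- The quotient algebra `Λ / I`, with underlying vector space the quotient of vector spaces. -/
def AlgIdeal.Quotient (I : AlgIdeal k Λ) : Type u := Λ ⧸ I.toSubmodule

namespace AlgIdeal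

instance (I : AlgIdeal k Λ) : AddCommGroup I.Quotient :=
  inferInstanceAs (AddCommGroup (Λ ⧸ I.toSubmodule))

instance (I : AlgIdeal k Λ) : Module k I.Quotient :=
  inferInstanceAs (Module k (Λ ⧸ I.toSubmodule))

/-- The canonical projection onto the quotient, as a linear map. -/
def proj (I : AlgIdeal k Λ) : Λ →ₗ[k] I.Quotient := I.toSubmodule.mkQ

theorem proj_surjective (I : AlgIdeal k Λ) : Function.Surjective I.proj :=
  Submodule.mkQ_surjective _

theorem proj_eq_proj (I : AlgIdeal k Λ) {x y : Λ} : I.proj x = I.proj y ↔ x - y ∈ I.toSubmodule :=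
  Submodule.Quotient.eq _

/-- `(x + I) (y + I) = x y + I`. -/
instance (I : AlgIdeal k Λ) : Mul I.Quotient where
  mul := Quotient.map₂ (· * ·) (by
    intro a a' ha b b' hb
    replace ha := (Submodule.quotientRel_def _).1 ha
    replace hb := (Submodule.quotientRel_def _).1 hb
    refine (Submodule.quotientRel_def _).2 ?_
    have : a * b - a' * b' = (a - a') * b + a' * (b - b') := by noncomm_ring
    rw [this]
    exact I.toSubmodule.add_mem (I.mul_mem_right _ _ ha) (I.mul_mem_left _ _ hb))

theorem proj_mul (I : AlgIdeal k Λ) (x y : Λ) : I.proj (x * y) = I.proj x * I.proj y := rfl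

instance (I : AlgIdeal k Λ) : NonUnitalRing I.Quotient :=
  { (inferInstance : AddCommGroup I.Quotient), (inferInstance : Mul I.Quotient) with
    left_distrib := by
      intro a b c
      obtain ⟨a, rfl⟩ := I.proj_surjective a
      obtain ⟨b, rfl⟩ := I.proj_surjective b
      obtain ⟨c, rfl⟩ := I.proj_surjective c
      rw [← map_add, ← proj_mul, ← proj_mul, ← proj_mul, ← map_add, mul_add]
    right_distrib := by
      intro a b c
      obtain ⟨a, rfl⟩ := I.proj_surjective a
      obtain ⟨b, rfl⟩ := I.proj_surjective b
      obtain ⟨c, rfl⟩ := I.proj_surjective c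
      rw [← map_add, ← proj_mul, ← proj_mul, ← proj_mul, ← map_add, add_mul]
    zero_mul := by
      intro a
      obtain ⟨a, rfl⟩ := I.proj_surjective a
      rw [← map_zero I.proj, ← proj_mul, zero_mul]
    mul_zero := by
      intro a
      obtain ⟨a, rfl⟩ := I.proj_surjective a
      rw [← map_zero I.proj, ← proj_mul, mul_zero]
    mul_assoc := by
      intro a b c
      obtain ⟨a, rfl⟩ := I.proj_surjective a
      obtain ⟨b, rfl⟩ := I.proj_surjective b
      obtain ⟨c, rfl⟩ := I.proj_surjective c
      rw [← proj_mul, ← proj_mul, ← proj_mul, ← proj_mul, mul_assoc] }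

instance (I : AlgIdeal k Λ) [IsScalarTower k Λ Λ] : IsScalarTower k I.Quotient I.Quotient where
  smul_assoc := by
    intro c x y
    obtain ⟨x, rfl⟩ := I.proj_surjective x
    obtain ⟨y, rfl⟩ := I.proj_surjective y
    rw [smul_eq_mul, smul_eq_mul, ← map_smul, ← proj_mul, ← proj_mul, ← map_smul, smul_mul_assoc]

instance (I : AlgIdeal k Λ) [SMulCommClass k Λ Λ] : SMulCommClass k I.Quotient I.Quotient where
  smul_comm := by
    intro c x y
    obtain ⟨x, rfl⟩ := I.proj_surjective x
    obtain ⟨y, rfl⟩ := I.proj_surjective y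
    rw [smul_eq_mul, smul_eq_mul, ← map_smul, ← proj_mul, ← proj_mul, ← map_smul, mul_smul_comm]

/-- The two-sided ideal `(S)` generated by a set `S`: the intersection of all two-sided ideals
containing `S`. -/
def span (S : Set Λ) : AlgIdeal k Λ where
  toSubmodule := ⨅ (I : AlgIdeal k Λ) (_ : S ⊆ I.carrier), I.toSubmodule
  mul_mem_left := by
    intro a x hx
    change x ∈ (⨅ (I : AlgIdeal k Λ) (_ : S ⊆ I.carrier), I.toSubmodule) at hx
    change a * x ∈ (⨅ (I : AlgIdeal k Λ) (_ : S ⊆ I.carrier), I.toSubmodule)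
    simp only [Submodule.mem_iInf] at hx ⊢
    exact fun I hI => I.mul_mem_left _ _ (hx I hI)
  mul_mem_right := by
    intro x a hx
    change x ∈ (⨅ (I : AlgIdeal k Λ) (_ : S ⊆ I.carrier), I.toSubmodule) at hx
    change x * a ∈ (⨅ (I : AlgIdeal k Λ) (_ : S ⊆ I.carrier), I.toSubmodule)
    simp only [Submodule.mem_iInf] at hx ⊢
    exact fun I hI => I.mul_mem_right _ _ (hx I hI)

/-- The powers of an ideal: `I ^ 1 = I`, and `I ^ (n + 1)` is spanned by the products `x * y` with
`x ∈ I ^ n` and `y ∈ I`. (By convention `I ^ 0` is the whole algebra; it is never used below.) -/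
def pow (I : AlgIdeal k Λ) : ℕ → Submodule k Λ
  | 0 => ⊤
  | 1 => I.toSubmodule
  | n + 2 => Submodule.span k {z | ∃ x ∈ pow I (n + 1), ∃ y ∈ I.toSubmodule, z = x * y}

/-- An ideal is nilpotent if one of its positive powers is zero. -/
def IsNilpotent (I : AlgIdeal k Λ) : Prop := ∃ t : ℕ, 1 ≤ t ∧ I.pow t = ⊥

end AlgIdeal

end Ideals

section Radical

variable (k : Type v) (Λ : Type u) [Field k] [NonUnitalRing Λ] [Module k Λ]

/-- An element `y` of a ring is left quasi-regular if `z + y + z y = 0` for some `z`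
(in a unital ring: `1 + y` is left invertible). -/
def IsLeftQuasiRegular {R : Type u} [NonUnitalRing R] (y : R) : Prop := ∃ z : R, z + y + z * y = 0

theorem IsLeftQuasiRegular.mul_comm {R : Type u} [NonUnitalRing R] {x y : R}
    (h : IsLeftQuasiRegular (y * x)) : IsLeftQuasiRegular (x * y) := by
  obtain ⟨z, hz⟩ := h
  refine ⟨-(x * y) - x * z * y, ?_⟩
  have : -(x * y) - x * z * y + x * y + (-(x * y) - x * z * y) * (x * y)
      = -(x * (z + y * x + z * (y * x)) * y) := by noncomm_ring
  rw [this, hz]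
  simp

/-- The Jacobson radical `r(Λ)` of a (not necessarily unital) algebra: the set of all `x` such that
the left ideal `Λ x` consists of left quasi-regular elements. This is the largest left ideal all of
whose elements are left quasi-regular; in a unital ring it is the usual Jacobson radical. -/
def jacobsonRadical [IsScalarTower k Λ Λ] [SMulCommClass k Λ Λ] : AlgIdeal k Λ where
  carrier := {x | ∀ a : Λ, IsLeftQuasiRegular (a * x)}
  zero_mem' := fun a => ⟨0, by simp⟩
  add_mem' := by
    intro x y hx hy a
    obtain ⟨z, hz⟩ := hx a
    obtain ⟨w, hw⟩ := hy (a + z * a)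
    refine ⟨w + z + w * z, ?_⟩
    have : w + z + w * z + a * (x + y) + (w + z + w * z) * (a * (x + y))
        = (w + (a + z * a) * y + w * ((a + z * a) * y))
          + (z + a * x + z * (a * x)) + w * (z + a * x + z * (a * x)) := by noncomm_ring
    rw [this, hz, hw]
    simp
  smul_mem' := by
    intro c x hx a
    have := hx (c • a)
    rwa [smul_mul_assoc, ← mul_smul_comm] at this
  mul_mem_left := by
    intro b x hx a
    rw [← mul_assoc]
    exact hx _
  mul_mem_right := by
    intro x b hx a
    rw [← mul_assoc]
    apply IsLeftQuasiRegular.mul_comm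
    rw [← mul_assoc]
    exact hx _

end Radical

section Algebras

/-- Two `k`-algebras are isomorphic: there is a bijective `k`-linear multiplicative map. -/
def AlgIsomorphic (k : Type*) (A : Type*) (B : Type*) [Field k] [NonUnitalRing A] [Module k A]
    [NonUnitalRing B] [Module k B] : Prop :=
  ∃ φ : A →ₙₐ[k] B, Function.Bijective φ

variable (k : Type v) (Λ : Type u) [Field k] [NonUnitalRing Λ] [Module k Λ]
  [IsScalarTower k Λ Λ] [SMulCommClass k Λ Λ]

/-- `Λ` is a generalized elementary algebra: `Λ / r(Λ)` is isomorphic as an algebra to a direct sum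
`⊕_{i ∈ I} k` of copies of `k` (finitely supported functions with pointwise operations), where `I`
is a non-empty set. -/
def IsGeneralizedElementary : Prop :=
  ∃ (I : Type u) (_ : Nonempty I), AlgIsomorphic k (jacobsonRadical k Λ).Quotient (I →₀ k)

/-- `Λ` can be lifted: `Λ = A ⊕ r(Λ)` as vector spaces for some subalgebra `A`. -/
def CanBeLifted : Prop :=
  ∃ A : NonUnitalSubalgebra k Λ, IsCompl A.toSubmodule (jacobsonRadical k Λ).toSubmodule

/-- `e` is a complete set of pairwise orthogonal idempotents with index set `I`. -/
structure IsCompleteOrthogonalSet {R : Type*} [NonUnitalRing R] {I : Type*} (e : I → R) :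
    Prop where
  idem : ∀ i, e i * e i = e i
  ortho : ∀ i j, i ≠ j → e i * e j = 0
  complete : ∀ x : R, ∃ F : Finset I, (∑ i ∈ F, e i) * x = x ∧ x * (∑ i ∈ F, e i) = x
  ne_zero : ∀ i, e i ≠ 0

/-- The ring `R` has a complete set of pairwise orthogonal idempotents, with some non-empty index
set. -/
def HasCompleteOrthogonalSet (R : Type u) [NonUnitalRing R] : Prop :=
  ∃ (I : Type u) (_ : Nonempty I) (e : I → R), IsCompleteOrthogonalSet e

end Algebras

section PathAlgebras

/-- The set of all paths of a directed graph with vertex set `V`, including the path of length `0`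
at every vertex. -/
structure DirPath (V : Type u) [Quiver.{u} V] : Type u where
  source : V
  target : V
  path : Quiver.Path source target

/-- The path algebra of a directed graph: the vector space with basis the set of all paths. -/
def PathAlgebra (k : Type v) (V : Type u) [Field k] [Quiver.{u} V] : Type (max u v) :=
  DirPath V →₀ k

namespace PathAlgebra

variable (k : Type v) (V : Type u) [Field k] [Quiver.{u} V]

noncomputable instance : AddCommGroup (PathAlgebra k V) :=
  inferInstanceAs (AddCommGroup (DirPath V →₀ k))

noncomputable instance : Module k (PathAlgebra k V) :=
  inferInstanceAs (Module k (DirPath V →₀ k))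

variable {V}

/-- The basis element of the path algebra given by a path from `a` to `b`. -/
noncomputable def ofPath {a b : V} (p : Quiver.Path a b) : PathAlgebra k V :=
  Finsupp.single (⟨a, b, p⟩ : DirPath V) 1

open Classical in
/-- The product of two paths: the concatenation (first `p`, then `q`) if `p` ends where `q` starts,
and zero otherwise. -/
noncomputable def pathMul (p q : DirPath V) : PathAlgebra k V :=
  if h : q.source = p.target then ofPath k (p.path.comp (q.path.cast h rfl)) else 0

variable (V)

/-- The bilinear extension of the product of paths. -/
noncomputable def mulLin : PathAlgebra k V →ₗ[k] PathAlgebra k V →ₗ[k] PathAlgebra k V :=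
  Finsupp.linearCombination k fun p : DirPath V =>
    (Finsupp.linearCombination k fun q : DirPath V => pathMul k p q :
      (DirPath V →₀ k) →ₗ[k] PathAlgebra k V)

noncomputable instance : Mul (PathAlgebra k V) := ⟨fun x y => mulLin k V x y⟩

variable {k V}

theorem mul_def (x y : PathAlgebra k V) : x * y = mulLin k V x y := rfl

theorem ofPath_mul {a b c d : V} (p : Quiver.Path a b) (q : Quiver.Path c d) :
    ofPath k p * ofPath k q = pathMul k ⟨a, b, p⟩ ⟨c, d, q⟩ := by
  change (Finsupp.linearCombination k fun p : DirPath V =>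
    (Finsupp.linearCombination k fun q : DirPath V => pathMul k p q :
      (DirPath V →₀ k) →ₗ[k] PathAlgebra k V)) (Finsupp.single (⟨a, b, p⟩ : DirPath V) 1)
      (Finsupp.single (⟨c, d, q⟩ : DirPath V) 1) = _
  rw [Finsupp.linearCombination_single, one_smul, Finsupp.linearCombination_single, one_smul]

theorem ofPath_mul_ofPath {a b c : V} (p : Quiver.Path a b) (q : Quiver.Path b c) :
    ofPath k p * ofPath k q = ofPath k (p.comp q) := by
  rw [ofPath_mul, pathMul, dif_pos rfl]
  rfl

theorem ofPath_mul_ofPath_of_ne {a b c d : V} (p : Quiver.Path a b) (q : Quiver.Path c d)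
    (h : c ≠ b) : ofPath k p * ofPath k q = 0 := by
  rw [ofPath_mul, pathMul, dif_neg h]

theorem induction_on {P : PathAlgebra k V → Prop} (x : PathAlgebra k V) (zero : P 0)
    (add : ∀ x y, P x → P y → P (x + y))
    (single : ∀ (c : k) (a b : V) (p : Quiver.Path a b), P (c • ofPath k p)) : P x := by
  refine Finsupp.induction_linear (motive := P) x zero (fun f g => add f g) ?_
  rintro ⟨a, b, p⟩ c
  have h : c • ofPath k p = (Finsupp.single (⟨a, b, p⟩ : DirPath V) c : DirPath V →₀ k) :=
    (Finsupp.smul_single c _ _).trans (by simp)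
  exact h ▸ single c a b p

theorem ofPath_mul_assoc {a b c d e f : V} (p : Quiver.Path a b) (q : Quiver.Path c d)
    (r : Quiver.Path e f) :
    ofPath k p * ofPath k q * ofPath k r = ofPath k p * (ofPath k q * ofPath k r) := by
  by_cases h : c = b
  · subst h
    rw [ofPath_mul_ofPath]
    by_cases h' : e = d
    · subst h'
      rw [ofPath_mul_ofPath, ofPath_mul_ofPath, ofPath_mul_ofPath, Quiver.Path.comp_assoc]
    · rw [ofPath_mul_ofPath_of_ne _ _ h', ofPath_mul_ofPath_of_ne _ _ h', mul_def, map_zero]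
  · rw [ofPath_mul_ofPath_of_ne _ _ h]
    by_cases h' : e = d
    · subst h'
      rw [ofPath_mul_ofPath, ofPath_mul_ofPath_of_ne _ _ h, mul_def, map_zero]
      rfl
    · rw [ofPath_mul_ofPath_of_ne _ _ h', mul_def, mul_def, map_zero, map_zero]
      rfl

noncomputable instance : NonUnitalRing (PathAlgebra k V) :=
  { (inferInstance : AddCommGroup (PathAlgebra k V)), (inferInstance : Mul (PathAlgebra k V)) with
    left_distrib := fun a b c => by simp only [mul_def, map_add]
    right_distrib := fun a b c => by simp only [mul_def, map_add, LinearMap.add_apply]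
    zero_mul := fun a => by simp only [mul_def, map_zero, LinearMap.zero_apply]
    mul_zero := fun a => by simp only [mul_def, map_zero]
    mul_assoc := fun x y z => by
      induction x using induction_on with
      | zero => simp only [mul_def, map_zero, LinearMap.zero_apply]
      | add x x' hx hx' =>
        simp only [mul_def, map_add, LinearMap.add_apply] at hx hx' ⊢
        rw [hx, hx']
      | single c a b p =>
        induction y using induction_on with
        | zero => simp only [mul_def, map_zero, LinearMap.zero_apply]
        | add y y' hy hy' =>
          simp only [mul_def, map_add, LinearMap.add_apply] at hy hy' ⊢
          rw [hy, hy']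
        | single c' a' b' q =>
          induction z using induction_on with
          | zero => simp only [mul_def, map_zero]
          | add z z' hz hz' =>
            simp only [mul_def, map_add] at hz hz' ⊢
            rw [hz, hz']
          | single c'' a'' b'' r =>
            have := ofPath_mul_assoc (k := k) p q r
            simp only [mul_def, map_smul, LinearMap.smul_apply] at this ⊢
            rw [this] }

instance : IsScalarTower k (PathAlgebra k V) (PathAlgebra k V) where
  smul_assoc c x y := by
    simp only [smul_eq_mul, mul_def, map_smul, LinearMap.smul_apply]

instance : SMulCommClass k (PathAlgebra k V) (PathAlgebra k V) where
  smul_comm c x y := by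
    simp only [smul_eq_mul, mul_def, map_smul]

variable (k V)

/-- The ideal `J` of the path algebra generated by all arrows. -/
noncomputable def arrowIdeal : AlgIdeal k (PathAlgebra k V) :=
  AlgIdeal.span {x | ∃ (a b : V) (α : a ⟶ b), x = ofPath k α.toPath}

end PathAlgebra

/-- `Λ` is isomorphic to a path algebra with relations: there are a directed graph `D` (possibly
infinite, with multiple arrows and loops) with non-empty vertex set `V`, and a non-empty subset `ρ`
of `kD` with `J ^ t ⊆ (ρ) ⊆ J ^ 2` for some `t ≥ 1`, such that `Λ` is isomorphic to `kD / (ρ)`. -/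
def IsPathAlgebraWithRelations (k : Type v) (Λ : Type u) [Field k] [NonUnitalRing Λ]
    [Module k Λ] : Prop :=
  ∃ (V : Type u) (_ : Nonempty V) (_ : Quiver.{u} V) (ρ : Set (PathAlgebra k V)),
    ρ.Nonempty ∧
    (∃ t : ℕ, 1 ≤ t ∧
      (PathAlgebra.arrowIdeal k V).pow t ≤ (AlgIdeal.span ρ : AlgIdeal k _).toSubmodule) ∧
    (AlgIdeal.span ρ : AlgIdeal k _).toSubmodule ≤ (PathAlgebra.arrowIdeal k V).pow 2 ∧
    AlgIsomorphic k Λ (AlgIdeal.span ρ : AlgIdeal k (PathAlgebra k V)).Quotient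

end PathAlgebras

/-! Being a path algebra with relations amounts to having a surjection Φ : kD → Λ whose kernel lies
between some J^t and J^2 (`isPathAlgebraWithRelations_iff`).

Given such Φ, the projection of kD onto the span of its vertices has kernel J ⊇ ker Φ, so it
descends to π : Λ → ⊕ k. The kernel of π is covered by J, hence nilpotent, and a nilpotent ideal
with quotient ⊕ k is the radical: nilpotent elements are quasi-regular, while -1 in k is not. The
images of the vertices are a complete set of orthogonal idempotents and span a complement of the
radical.

Conversely, let N = r(Λ). The lifting yields orthogonal idempotents f_a over the coordinate vectors
of Λ/N = ⊕ k. They are the vertices; the arrows from a to b are a basis of f_a N f_b modulo N^2, and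
paths are evaluated in Λ. Surjectivity (`hom_surjective`): if N is contained in image + N^2,
nilpotency of N gives everything. The containment needs local units: a local unit agrees modulo N
with a combination of the f_a, so x in N is a sum of elements f_a x f_b modulo N^2
(`mem_of_peirce_mem`). Kernel in J^2 (`mem_pow_two_of_hom_eq_zero`): π detects the coefficients of
vertices, and Peirce components modulo N^2 detect those of arrows. Finally J maps into N, so a power
of J is killed. -/

namespace AlgIdeal

/-! ### Powers of ideals and homomorphisms -/

variable {k : Type v} [Field k]
variable {Λ : Type*} [NonUnitalRing Λ] [Module k Λ]
variable {Γ : Type*} [NonUnitalRing Γ] [Module k Γ]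

theorem pow_one (I : AlgIdeal k Λ) : I.pow 1 = I.toSubmodule := by
  rw [pow]

theorem pow_add_two (I : AlgIdeal k Λ) (n : ℕ) : I.pow (n + 2) =
    Submodule.span k {z | ∃ x ∈ I.pow (n + 1), ∃ y ∈ I.toSubmodule, z = x * y} := by
  rw [pow]

theorem mul_mem_pow_add_two (I : AlgIdeal k Λ) {n : ℕ} {x y : Λ} (hx : x ∈ I.pow (n + 1))
    (hy : y ∈ I.toSubmodule) : x * y ∈ I.pow (n + 2) := by
  rw [pow_add_two]
  exact Submodule.subset_span ⟨x, hx, y, hy, rfl⟩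

/-- The kernel of an algebra homomorphism, as a two-sided ideal. -/
def ker (f : Λ →ₙₐ[k] Γ) : AlgIdeal k Λ where
  carrier := {x | f x = 0}
  zero_mem' := map_zero f
  add_mem' := by
    intro x y hx hy
    rw [Set.mem_ofPred_eq] at *
    rw [map_add, hx, hy, add_zero]
  smul_mem' := by
    intro c x hx
    rw [Set.mem_ofPred_eq] at *
    rw [map_smul, hx, smul_zero]
  mul_mem_left := by
    intro a x hx
    change f x = 0 at hx
    change f (a * x) = 0
    rw [map_mul, hx, mul_zero]
  mul_mem_right := by
    intro x a hx
    change f x = 0 at hx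
    change f (x * a) = 0
    rw [map_mul, hx, zero_mul]

theorem mem_ker (f : Λ →ₙₐ[k] Γ) {x : Λ} : x ∈ (ker f).toSubmodule ↔ f x = 0 := Iff.rfl

theorem subset_span (S : Set Λ) {x : Λ} (hx : x ∈ S) :
    x ∈ (span S : AlgIdeal k Λ).toSubmodule := by
  change x ∈ (⨅ (I : AlgIdeal k Λ) (_ : S ⊆ I.carrier), I.toSubmodule)
  simp only [Submodule.mem_iInf]
  exact fun I hI => hI hx

theorem span_le {S : Set Λ} {I : AlgIdeal k Λ} (h : S ⊆ I.carrier) :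
    (span S : AlgIdeal k Λ).toSubmodule ≤ I.toSubmodule :=
  iInf₂_le I h

theorem map_mem_pow (f : Λ →ₙₐ[k] Γ) {I : AlgIdeal k Λ} {I' : AlgIdeal k Γ}
    (h : ∀ x ∈ I.toSubmodule, f x ∈ I'.toSubmodule) (n : ℕ) :
    ∀ x ∈ I.pow (n + 1), f x ∈ I'.pow (n + 1) := by
  induction n with
  | zero => simpa only [zero_add, pow_one] using h
  | succ n ih =>
    intro x hx
    rw [pow_add_two] at hx
    induction hx using Submodule.span_induction with
    | mem x hx =>
      obtain ⟨a, ha, b, hb, rfl⟩ := hx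
      rw [map_mul]
      exact I'.mul_mem_pow_add_two (ih a ha) (h b hb)
    | zero => rw [map_zero]; exact zero_mem _
    | add x y _ _ hx hy => rw [map_add]; exact add_mem hx hy
    | smul c x _ hx => rw [map_smul]; exact Submodule.smul_mem _ _ hx

/-- Products lift factor by factor. This transfers nilpotency: if `f` kills a power of `I` and `I'`
is covered by `I`, that power of `I'` is zero. -/
theorem exists_mem_pow_of_mem_pow (f : Λ →ₙₐ[k] Γ) {I : AlgIdeal k Λ} {I' : AlgIdeal k Γ}
    (h : ∀ y ∈ I'.toSubmodule, ∃ x ∈ I.toSubmodule, f x = y) (n : ℕ) :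
    ∀ y ∈ I'.pow (n + 1), ∃ x ∈ I.pow (n + 1), f x = y := by
  induction n with
  | zero => simpa only [zero_add, pow_one] using h
  | succ n ih =>
    intro y hy
    rw [pow_add_two] at hy
    induction hy using Submodule.span_induction with
    | mem x hx =>
      obtain ⟨a, ha, b, hb, rfl⟩ := hx
      obtain ⟨a, ha', rfl⟩ := ih a ha
      obtain ⟨b, hb', rfl⟩ := h b hb
      exact ⟨a * b, I.mul_mem_pow_add_two ha' hb', map_mul f a b⟩
    | zero => exact ⟨0, zero_mem _, map_zero f⟩
    | add x y _ _ hx hy =>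
      obtain ⟨a, ha, rfl⟩ := hx
      obtain ⟨b, hb, rfl⟩ := hy
      exact ⟨a + b, add_mem ha hb, map_add f a b⟩
    | smul c x _ hx =>
      obtain ⟨a, ha, rfl⟩ := hx
      exact ⟨c • a, Submodule.smul_mem _ _ ha, map_smul f c a⟩

theorem pow_mul_pow_mem [SMulCommClass k Λ Λ] (I : AlgIdeal k Λ) {m : ℕ} {x : Λ} (hx : x ∈ I.pow (m + 1)) (n : ℕ) :
    ∀ y ∈ I.pow (n + 1), x * y ∈ I.pow (m + n + 2) := by
  induction n with
  | zero =>
    intro y hy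
    rw [zero_add, pow_one] at hy
    exact I.mul_mem_pow_add_two hx hy
  | succ n ih =>
    intro y hy
    rw [pow_add_two] at hy
    induction hy using Submodule.span_induction with
    | mem y hy =>
      obtain ⟨a, ha, b, hb, rfl⟩ := hy
      rw [← mul_assoc]
      exact I.mul_mem_pow_add_two (ih a ha) hb
    | zero => rw [mul_zero]; exact zero_mem _
    | add y z _ _ hy hz => rw [mul_add]; exact add_mem hy hz
    | smul c y _ hy => rw [mul_smul_comm]; exact Submodule.smul_mem _ _ hy

theorem mul_mem_pow_left [SMulCommClass k Λ Λ] (I : AlgIdeal k Λ) (a : Λ) (n : ℕ) :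
    ∀ x ∈ I.pow (n + 1), a * x ∈ I.pow (n + 1) := by
  induction n with
  | zero =>
    intro x hx
    rw [zero_add, pow_one] at *
    exact I.mul_mem_left _ _ hx
  | succ n ih =>
    intro x hx
    rw [pow_add_two] at hx
    induction hx using Submodule.span_induction with
    | mem y hy =>
      obtain ⟨x, hx, y, hy, rfl⟩ := hy
      rw [← mul_assoc]
      exact I.mul_mem_pow_add_two (ih x hx) hy
    | zero => rw [mul_zero]; exact zero_mem _
    | add y z _ _ hy hz => rw [mul_add]; exact add_mem hy hz
    | smul c y _ hy => rw [mul_smul_comm]; exact Submodule.smul_mem _ _ hy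

theorem mul_mem_pow_right [IsScalarTower k Λ Λ] (I : AlgIdeal k Λ) (a : Λ) (n : ℕ) :
    ∀ x ∈ I.pow (n + 1), x * a ∈ I.pow (n + 1) := by
  cases n with
  | zero =>
    intro x hx
    rw [zero_add, pow_one] at *
    exact I.mul_mem_right _ _ hx
  | succ n =>
    intro x hx
    rw [pow_add_two] at hx
    induction hx using Submodule.span_induction with
    | mem y hy =>
      obtain ⟨x, hx, y, hy, rfl⟩ := hy
      rw [mul_assoc]
      exact I.mul_mem_pow_add_two hx (I.mul_mem_right _ _ hy)
    | zero => rw [zero_mul]; exact zero_mem _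
    | add y z _ _ hy hz => rw [add_mul]; exact add_mem hy hz
    | smul c y _ hy => rw [smul_mul_assoc]; exact Submodule.smul_mem _ _ hy

theorem pow_add_two_le [IsScalarTower k Λ Λ] (I : AlgIdeal k Λ) (n : ℕ) : I.pow (n + 2) ≤ I.pow (n + 1) := by
  rw [pow_add_two, Submodule.span_le]
  rintro _ ⟨x, hx, y, -, rfl⟩
  exact I.mul_mem_pow_right _ _ _ hx

theorem pow_two_le [IsScalarTower k Λ Λ] (I : AlgIdeal k Λ) : I.pow 2 ≤ I.toSubmodule := by
  simpa only [zero_add, pow_one] using I.pow_add_two_le 0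

theorem mul_mem_pow_two (I : AlgIdeal k Λ) {x y : Λ} (hx : x ∈ I.toSubmodule)
    (hy : y ∈ I.toSubmodule) : x * y ∈ I.pow 2 := by
  refine I.mul_mem_pow_add_two (n := 0) ?_ hy
  rwa [zero_add, pow_one]

end AlgIdeal

/-! ### Isomorphism theorems -/

section Factorization

variable {k : Type v} [Field k]
variable {A B C : Type*} [NonUnitalRing A] [Module k A] [NonUnitalRing B] [Module k B]
  [NonUnitalRing C] [Module k C]

/-- An algebra homomorphism that vanishes on the kernel of a surjective one factors through it. -/
theorem NonUnitalAlgHom.exists_factor (f : A →ₙₐ[k] B) (hf : Function.Surjective f)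
    (g : A →ₙₐ[k] C) (h : ∀ x, f x = 0 → g x = 0) :
    ∃ g' : B →ₙₐ[k] C, ∀ x, g' (f x) = g x := by
  -- The chosen preimage of `f x` differs from `x` by an element of the kernel of `f`, so `g` does
  -- not see the choice.
  have key : ∀ x, g (Function.surjInv hf (f x)) = g x := by
    intro x
    rw [← sub_eq_zero, ← map_sub]
    apply h
    rw [map_sub, Function.surjInv_eq hf, sub_self]
  refine ⟨{
    toFun := fun y => g (Function.surjInv hf y)
    map_smul' := ?_
    map_zero' := ?_
    map_add' := ?_
    map_mul' := ?_ }, key⟩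
  · intro c y
    obtain ⟨x, rfl⟩ := hf y
    rw [MonoidHom.id_apply, ← map_smul f, key, key, map_smul]
  · rw [← map_zero f, key, map_zero]
  · intro y y'
    obtain ⟨x, rfl⟩ := hf y
    obtain ⟨x', rfl⟩ := hf y'
    rw [← map_add f, key, key, key, map_add]
  · intro y y'
    obtain ⟨x, rfl⟩ := hf y
    obtain ⟨x', rfl⟩ := hf y'
    rw [← map_mul f, key, key, key, map_mul]

/-- The projection onto a quotient algebra as an algebra homomorphism. -/
def AlgIdeal.projHom (I : AlgIdeal k A) : A →ₙₐ[k] I.Quotient :=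
  { I.proj with
    map_zero' := map_zero I.proj
    map_mul' := I.proj_mul }

theorem AlgIdeal.projHom_surjective (I : AlgIdeal k A) : Function.Surjective I.projHom :=
  I.proj_surjective

theorem AlgIdeal.projHom_eq_zero (I : AlgIdeal k A) {x : A} :
    I.projHom x = 0 ↔ x ∈ I.toSubmodule :=
  Submodule.Quotient.mk_eq_zero _

/-- An algebra is isomorphic to a quotient by an ideal iff that ideal is the kernel of a
surjection onto it. -/
theorem algIsomorphic_quotient_iff (I : AlgIdeal k A) : AlgIsomorphic k B I.Quotient ↔
    ∃ f : A →ₙₐ[k] B, Function.Surjective f ∧ ∀ x, f x = 0 ↔ x ∈ I.toSubmodule := by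
  constructor
  · rintro ⟨φ, hφ⟩
    -- Factoring the identity through the bijection `φ` produces its inverse.
    obtain ⟨ψ, hψ⟩ := φ.exists_factor hφ.2 (NonUnitalAlgHom.id k B) fun x hx =>
      hφ.1 (hx.trans (map_zero φ).symm)
    have hψ' : ∀ y, φ (ψ y) = y := by
      intro y
      obtain ⟨x, rfl⟩ := hφ.2 y
      rw [hψ]
      rfl
    refine ⟨ψ.comp I.projHom, ?_, fun x => ?_⟩
    · intro b
      obtain ⟨x, hx⟩ := I.projHom_surjective (φ b)
      exact ⟨x, by rw [NonUnitalAlgHom.comp_apply, hx, hψ]; rfl⟩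
    · rw [NonUnitalAlgHom.comp_apply, ← I.projHom_eq_zero]
      refine ⟨fun h => ?_, fun h => by rw [h, map_zero]⟩
      rw [← hψ' (I.projHom x), h, map_zero]
  · rintro ⟨f, hf, hfI⟩
    obtain ⟨φ, hφ⟩ := f.exists_factor hf I.projHom fun x hx =>
      I.projHom_eq_zero.2 ((hfI x).1 hx)
    refine ⟨φ, ?_, ?_⟩
    · rw [injective_iff_map_eq_zero]
      intro b hb
      obtain ⟨x, rfl⟩ := hf b
      rw [hφ, I.projHom_eq_zero] at hb
      exact (hfI x).2 hb
    · intro q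
      obtain ⟨x, rfl⟩ := I.projHom_surjective q
      exact ⟨f x, hφ x⟩

/-- First isomorphism theorem in the direction required by `IsGeneralizedElementary`, opposite to
that of `algIsomorphic_quotient_iff`. -/
theorem algIsomorphic_of_quotient (I : AlgIdeal k A) (f : A →ₙₐ[k] B)
    (hf : Function.Surjective f) (h : ∀ x, f x = 0 ↔ x ∈ I.toSubmodule) :
    AlgIsomorphic k I.Quotient B := by
  obtain ⟨φ, hφ⟩ := I.projHom.exists_factor I.projHom_surjective f fun x hx =>
    (h x).2 (I.projHom_eq_zero.1 hx)
  refine ⟨φ, ?_, ?_⟩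
  · rw [injective_iff_map_eq_zero]
    intro q hq
    obtain ⟨x, rfl⟩ := I.projHom_surjective q
    rw [hφ, h] at hq
    exact I.projHom_eq_zero.2 hq
  · intro b
    obtain ⟨x, rfl⟩ := hf b
    exact ⟨I.projHom x, hφ x⟩

end Factorization

/-! ### Nilpotent ideals and the Jacobson radical -/

section Radical

variable {k : Type v} {Λ : Type u} [Field k] [NonUnitalRing Λ] [Module k Λ]

/-- Geometric series: `z = -y + y² - ...` terminates. Iterating `z ↦ -y - z * y` from `0` multiplies
the error `z + y + z * y` by `-y` each time, pushing it into the next power of `N`. -/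
theorem AlgIdeal.IsNilpotent.isLeftQuasiRegular {N : AlgIdeal k Λ} (hN : N.IsNilpotent) {y : Λ}
    (hy : y ∈ N.toSubmodule) : IsLeftQuasiRegular y := by
  have key : ∀ n : ℕ, ∃ z, z + y + z * y ∈ N.pow (n + 1) := by
    intro n
    induction n with
    | zero => exact ⟨0, by simpa [AlgIdeal.pow_one] using hy⟩
    | succ n ih =>
      obtain ⟨z, hz⟩ := ih
      refine ⟨-y - z * y, ?_⟩
      have : -y - z * y + y + (-y - z * y) * y = -((z + y + z * y) * y) := by noncomm_ring
      rw [this]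
      exact neg_mem (N.mul_mem_pow_add_two hz hy)
  obtain ⟨t, ht, h⟩ := hN
  obtain ⟨n, rfl⟩ := Nat.exists_eq_add_of_le' ht
  obtain ⟨z, hz⟩ := key n
  rw [h, Submodule.mem_bot] at hz
  exact ⟨z, hz⟩

variable [IsScalarTower k Λ Λ] [SMulCommClass k Λ Λ]

theorem mem_jacobsonRadical {x : Λ} : x ∈ (jacobsonRadical k Λ).toSubmodule ↔
    ∀ a : Λ, IsLeftQuasiRegular (a * x) := Iff.rfl

/-- A nilpotent ideal whose quotient is a direct sum of copies of the base field is the Jacobson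
radical. -/
theorem mem_jacobsonRadical_iff_of_isNilpotent_ker {V : Type*} {π : Λ →ₙₐ[k] (V →₀ k)}
    (hπ : Function.Surjective π) (hN : (AlgIdeal.ker π).IsNilpotent) {x : Λ} :
    x ∈ (jacobsonRadical k Λ).toSubmodule ↔ π x = 0 := by
  rw [mem_jacobsonRadical]
  refine ⟨fun h => ?_, fun h a => hN.isLeftQuasiRegular ((AlgIdeal.ker π).mul_mem_left a x h)⟩
  by_contra hx
  obtain ⟨i, hi⟩ := Finsupp.ne_iff.1 hx
  -- With this `a` the coordinate of `π (a * x)` at `i` is `-1`, which is not quasi-regular in `k`: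
  -- `z + (-1) + z * (-1) = -1`.
  obtain ⟨a, ha⟩ := hπ (Finsupp.single i (-(π x i)⁻¹))
  obtain ⟨z, hz⟩ := h a
  have hz := congrArg (fun y => π y i) hz
  simp only [map_add, map_mul, map_zero, ha, Finsupp.add_apply, Finsupp.mul_apply,
    Finsupp.single_eq_same, Finsupp.zero_apply] at hz
  rw [Finsupp.zero_apply] at hi
  rw [neg_mul, inv_mul_cancel₀ hi] at hz
  simp at hz

theorem jacobsonRadical_eq_ker_of_isNilpotent {V : Type*} {π : Λ →ₙₐ[k] (V →₀ k)}
    (hπ : Function.Surjective π) (hN : (AlgIdeal.ker π).IsNilpotent) :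
    jacobsonRadical k Λ = AlgIdeal.ker π := by
  have h : (jacobsonRadical k Λ).toSubmodule = (AlgIdeal.ker π).toSubmodule :=
    Submodule.ext fun x => mem_jacobsonRadical_iff_of_isNilpotent_ker hπ hN
  cases h1 : jacobsonRadical k Λ
  cases h2 : AlgIdeal.ker π
  rw [h1, h2] at h
  cases h
  rfl

end Radical

/-! ### Orthogonal idempotents as homomorphisms from ⊕ k -/

section IdempotentHom

variable {k : Type v} [Field k] {V : Type*} {B : Type*} [NonUnitalRing B] [Module k B]
  [IsScalarTower k B B] [SMulCommClass k B B]

/-- The homomorphism from a direct sum of copies of the base field given by pairwise orthogonal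
idempotents. -/
noncomputable def idempotentHom (f : V → B) (idem : ∀ i, f i * f i = f i)
    (ortho : ∀ i j, i ≠ j → f i * f j = 0) : (V →₀ k) →ₙₐ[k] B :=
  { Finsupp.linearCombination k f with
    map_zero' := map_zero (Finsupp.linearCombination k f)
    map_mul' := by
      intro x y
      change Finsupp.linearCombination k f (x * y) =
        Finsupp.linearCombination k f x * Finsupp.linearCombination k f y
      induction x using Finsupp.induction_linear with
      | zero => simp
      | add x x' hx hx' => rw [add_mul, map_add, hx, hx', map_add, add_mul]
      | single i c =>
        induction y using Finsupp.induction_linear with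
        | zero => simp
        | add y y' hy hy' => rw [mul_add, map_add, hy, hy', map_add, mul_add]
        | single j d =>
          rw [Finsupp.linearCombination_single, Finsupp.linearCombination_single,
            smul_mul_smul_comm]
          by_cases h : i = j
          · subst h
            rw [← Finsupp.single_mul, Finsupp.linearCombination_single, idem]
          · have h0 : Finsupp.single i c * Finsupp.single j d = (0 : V →₀ k) := by
              ext l
              rw [Finsupp.mul_apply, Finsupp.zero_apply]
              by_cases hl : l = i
              · rw [Finsupp.single_eq_of_ne (a := j) (by rintro rfl; exact h hl.symm), mul_zero]
              · rw [Finsupp.single_eq_of_ne hl, zero_mul]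
            rw [ortho i j h, h0, map_zero, smul_zero] }

theorem idempotentHom_apply (f : V → B) (idem : ∀ i, f i * f i = f i)
    (ortho : ∀ i j, i ≠ j → f i * f j = 0) (c : V →₀ k) :
    idempotentHom f idem ortho c = Finsupp.linearCombination k f c := rfl

end IdempotentHom

/-! ### Path algebras: homomorphisms out of them, coefficients, J and J^2 -/

namespace PathAlgebra

variable {k : Type v} {V : Type u} [Field k] [Quiver.{u} V]

section Lift

variable {B : Type*} [NonUnitalRing B] [Module k B] [IsScalarTower k B B] [SMulCommClass k B B]

/-- The algebra homomorphism on the path algebra given by a multiplicative assignment on paths. -/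
noncomputable def lift (F : DirPath V → B)
    (hF : ∀ (a b c : V) (p : Quiver.Path a b) (q : Quiver.Path b c),
      F ⟨a, b, p⟩ * F ⟨b, c, q⟩ = F ⟨a, c, p.comp q⟩)
    (hF' : ∀ (a b c d : V) (p : Quiver.Path a b) (q : Quiver.Path c d), c ≠ b →
      F ⟨a, b, p⟩ * F ⟨c, d, q⟩ = 0) : PathAlgebra k V →ₙₐ[k] B :=
  let L : PathAlgebra k V →ₗ[k] B := Finsupp.linearCombination k F
  have hL : ∀ {a b : V} (p : Quiver.Path a b), L (ofPath k p) = F ⟨a, b, p⟩ := fun p =>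
    (Finsupp.linearCombination_single k 1 _).trans (one_smul k _)
  { L with
    map_zero' := map_zero L
    map_mul' := by
      intro x y
      change L (x * y) = L x * L y
      induction x using induction_on with
      | zero => simp
      | add x x' hx hx' => rw [add_mul, map_add, hx, hx', map_add, add_mul]
      | single c a b p =>
        induction y using induction_on with
        | zero => simp
        | add y y' hy hy' => rw [mul_add, map_add, hy, hy', map_add, mul_add]
        | single c' a' b' q =>
          rw [smul_mul_smul_comm, map_smul, map_smul, map_smul, smul_mul_smul_comm, hL, hL]
          by_cases h : a' = b
          · subst h
            rw [ofPath_mul_ofPath, hL, hF]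
          · rw [ofPath_mul_ofPath_of_ne _ _ h, hF' _ _ _ _ _ _ h, map_zero] }

theorem lift_ofPath (F : DirPath V → B)
    (hF : ∀ (a b c : V) (p : Quiver.Path a b) (q : Quiver.Path b c),
      F ⟨a, b, p⟩ * F ⟨b, c, q⟩ = F ⟨a, c, p.comp q⟩)
    (hF' : ∀ (a b c d : V) (p : Quiver.Path a b) (q : Quiver.Path c d), c ≠ b →
      F ⟨a, b, p⟩ * F ⟨c, d, q⟩ = 0) {a b : V} (p : Quiver.Path a b) :
    lift (k := k) F hF hF' (ofPath k p) = F ⟨a, b, p⟩ :=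
  (Finsupp.linearCombination_single k 1 _).trans (one_smul k _)

end Lift

/-- The coefficient of a path. -/
noncomputable def coeff (p : DirPath V) : PathAlgebra k V →ₗ[k] k := Finsupp.lapply p

open Classical in
theorem coeff_ofPath (p : DirPath V) {a b : V} (q : Quiver.Path a b) :
    coeff p (ofPath k q) = if p = ⟨a, b, q⟩ then 1 else 0 := by
  change (Finsupp.single (⟨a, b, q⟩ : DirPath V) (1 : k)) p = _
  rw [Finsupp.single_apply]
  simp only [eq_comm]

theorem mem_of_forall_coeff {T : Submodule k (PathAlgebra k V)} {x : PathAlgebra k V}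
    (h : ∀ {a b : V} (p : Quiver.Path a b), coeff ⟨a, b, p⟩ x ≠ 0 → ofPath k p ∈ T) : x ∈ T := by
  have hx : (Finsupp.sum (M := k) x fun p c => (c • ofPath k p.path : PathAlgebra k V)) = x := by
    refine Eq.trans ?_ (Finsupp.sum_single (M := k) x)
    refine Finset.sum_congr rfl fun p _ => ?_
    exact (Finsupp.smul_single _ _ _).trans (by rw [smul_eq_mul, mul_one])
  rw [← hx]
  exact Submodule.sum_mem _ fun p hp =>
    T.smul_mem _ (h p.path (Finsupp.mem_support_iff.1 hp))

theorem ofPath_toPath_mem_arrowIdeal {a b : V} (α : a ⟶ b) :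
    ofPath k α.toPath ∈ (arrowIdeal k V).toSubmodule :=
  AlgIdeal.subset_span _ ⟨a, b, α, rfl⟩

theorem ofPath_cons {a b c : V} (p : Quiver.Path a b) (α : b ⟶ c) :
    ofPath k (p.cons α) = ofPath k p * ofPath k α.toPath :=
  (ofPath_mul_ofPath p α.toPath).symm

theorem ofPath_cons_mem_arrowIdeal {a b c : V} (p : Quiver.Path a b) (α : b ⟶ c) :
    ofPath k (p.cons α) ∈ (arrowIdeal k V).toSubmodule := by
  rw [ofPath_cons]
  exact (arrowIdeal k V).mul_mem_left _ _ (ofPath_toPath_mem_arrowIdeal α)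

theorem ofPath_cons_cons_mem_pow_two {a b c d : V} (p : Quiver.Path a b) (α : b ⟶ c)
    (β : c ⟶ d) : ofPath k ((p.cons α).cons β) ∈ (arrowIdeal k V).pow 2 := by
  rw [ofPath_cons]
  exact (arrowIdeal k V).mul_mem_pow_two (ofPath_cons_mem_arrowIdeal p α)
    (ofPath_toPath_mem_arrowIdeal β)

instance : IsScalarTower k (V →₀ k) (V →₀ k) where
  smul_assoc c x y := by
    ext i
    simp [mul_assoc]

instance : SMulCommClass k (V →₀ k) (V →₀ k) where
  smul_comm c x y := by
    ext i
    simp [mul_left_comm]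

variable (k V)

/-- The projection of the path algebra onto the span of the paths of length `0`. -/
noncomputable def vertexProj : PathAlgebra k V →ₙₐ[k] (V →₀ k) :=
  lift (fun p => if p.path.length = 0 then Finsupp.single p.source 1 else 0)
    (by
      intro a b c p q
      cases p with
      | nil => cases q <;> simp [← Finsupp.single_mul]
      | cons p α => simp)
    (by
      intro a b c d p q h
      cases p with
      | cons p α => simp
      | nil =>
        cases q with
        | cons q β => simp
        | nil =>
          classical
          ext l
          simp only [Quiver.Path.length_nil, if_true, Finsupp.mul_apply, Finsupp.single_apply,
            Finsupp.zero_apply]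
          grind)

variable {k V}

theorem vertexProj_nil (a : V) :
    vertexProj k V (ofPath k (Quiver.Path.nil : Quiver.Path a a)) = Finsupp.single a 1 :=
  lift_ofPath _ _ _ _

theorem vertexProj_cons {a b c : V} (p : Quiver.Path a b) (α : b ⟶ c) :
    vertexProj k V (ofPath k (p.cons α)) = 0 :=
  (lift_ofPath _ _ _ _).trans (if_neg (Nat.succ_ne_zero _))

theorem vertexProj_apply (x : PathAlgebra k V) (a : V) :
    vertexProj k V x a = coeff ⟨a, a, Quiver.Path.nil⟩ x := by
  induction x using induction_on with
  | zero => simp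
  | add x y hx hy => rw [map_add, map_add, Finsupp.add_apply, hx, hy]
  | single c b d p =>
    rw [map_smul, map_smul, Finsupp.smul_apply]
    congr 1
    classical
    rw [coeff_ofPath]
    cases p with
    | nil =>
      rw [vertexProj_nil, Finsupp.single_apply]
      refine if_congr ⟨?_, ?_⟩ rfl rfl
      · rintro rfl
        rfl
      · intro h
        injection h with h
        exact h.symm
    | cons p α =>
      rw [vertexProj_cons, if_neg, Finsupp.zero_apply]
      intro h
      injection h with h1 h2 h3
      subst h1
      subst h2
      exact Quiver.Path.nil_ne_cons _ _ (eq_of_heq h3)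

/-- The kernel of `vertexProj` is an ideal containing the arrows. Conversely an element of it
involves no path of length `0`, and every longer path is a multiple of an arrow. -/
theorem mem_arrowIdeal_iff {x : PathAlgebra k V} :
    x ∈ (arrowIdeal k V).toSubmodule ↔ vertexProj k V x = 0 := by
  constructor
  · intro h
    refine (AlgIdeal.mem_ker _).1 (AlgIdeal.span_le ?_ h)
    rintro _ ⟨a, b, α, rfl⟩
    exact vertexProj_cons _ α
  · intro h
    refine mem_of_forall_coeff fun {a b} p hp => ?_
    cases p with
    | nil => rw [← vertexProj_apply, h] at hp; exact absurd rfl hp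
    | cons p α => exact ofPath_cons_mem_arrowIdeal p α

/-- The coefficients of the arrows from `a` to `b`. -/
noncomputable def arrowCoeff (a b : V) : PathAlgebra k V →ₗ[k] ((a ⟶ b) →₀ k) :=
  Finsupp.lcomapDomain (fun α : a ⟶ b => (⟨a, b, α.toPath⟩ : DirPath V)) (by
    intro α β h
    injection h with _ _ h
    injection h)

theorem arrowCoeff_apply {a b : V} (x : PathAlgebra k V) (α : a ⟶ b) :
    arrowCoeff a b x α = coeff ⟨a, b, α.toPath⟩ x := rfl

theorem arrowCoeff_toPath {a b : V} (α : a ⟶ b) :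
    arrowCoeff a b (ofPath k α.toPath) = Finsupp.single α 1 := by
  classical
  ext β
  rw [arrowCoeff_apply, coeff_ofPath, Finsupp.single_apply]
  refine if_congr ⟨?_, ?_⟩ rfl rfl
  · intro h
    injection h with _ _ h
    injection h with _ _ _ h
    exact h.symm
  · rintro rfl
    rfl

theorem arrowCoeff_eq_zero {a b c d : V} (p : Quiver.Path c d)
    (h : ∀ α : a ⟶ b, (⟨a, b, α.toPath⟩ : DirPath V) ≠ ⟨c, d, p⟩) :
    arrowCoeff a b (ofPath k p) = 0 := by
  classical
  ext β
  rw [arrowCoeff_apply, coeff_ofPath, if_neg (h β), Finsupp.zero_apply]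

/-- The hypotheses remove all paths of length `0` and `1`, and each longer path lies in J^2. -/
theorem mem_arrowIdeal_pow_two {x : PathAlgebra k V} (h : vertexProj k V x = 0)
    (h' : ∀ a b : V, arrowCoeff a b x = 0) : x ∈ (arrowIdeal k V).pow 2 := by
  refine mem_of_forall_coeff fun {a b} p hp => ?_
  cases p with
  | nil => rw [← vertexProj_apply, h] at hp; exact absurd rfl hp
  | cons p α =>
    cases p with
    | nil => exact absurd (DFunLike.congr_fun (h' _ _) α) hp
    | cons p β => exact ofPath_cons_cons_mem_pow_two p β α

/-! ### Evaluating paths in an algebra -/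

section Eval

variable {B : Type*} [NonUnitalRing B] [Module k B] [IsScalarTower k B B] [SMulCommClass k B B]

/-- The product of the values of the arrows of a path; the path of length `0` at `a` is sent
to `f a`. -/
def evalPath (f : V → B) (v : ∀ {a b : V}, (a ⟶ b) → B) {a : V} :
    ∀ {b : V}, Quiver.Path a b → B
  | _, .nil => f a
  | _, .cons p α => evalPath f v p * v α

/-- Pairwise orthogonal idempotents for the vertices and compatible elements for the arrows. -/
structure IsRepresentation (f : V → B) (v : ∀ {a b : V}, (a ⟶ b) → B) : Prop where
  idem : ∀ i, f i * f i = f i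
  ortho : ∀ i j, i ≠ j → f i * f j = 0
  left : ∀ {a b : V} (α : a ⟶ b), f a * v α = v α
  right : ∀ {a b : V} (α : a ⟶ b), v α * f b = v α

namespace IsRepresentation

variable {f : V → B} {v : ∀ {a b : V}, (a ⟶ b) → B}

section
variable (h : IsRepresentation f v)
include h

/-- `α.toPath` is `nil.cons α`, so its value unfolds to `f a * v α`. -/
theorem evalPath_toPath {a b : V} (α : a ⟶ b) : evalPath f v α.toPath = v α := h.left α

theorem evalPath_mul_right {a b : V} (p : Quiver.Path a b) :
    evalPath f v p * f b = evalPath f v p := by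
  cases p with
  | nil => exact h.idem a
  | cons p α => rw [evalPath, mul_assoc, h.right]

theorem mul_evalPath_left {a b : V} (p : Quiver.Path a b) :
    f a * evalPath f v p = evalPath f v p := by
  induction p with
  | nil => exact h.idem a
  | cons p α ih => rw [evalPath, ← mul_assoc, ih]

theorem evalPath_comp {a b c : V} (p : Quiver.Path a b) (q : Quiver.Path b c) :
    evalPath f v p * evalPath f v q = evalPath f v (p.comp q) := by
  induction q with
  | nil => exact h.evalPath_mul_right p
  | cons q α ih => rw [Quiver.Path.comp_cons, evalPath, evalPath, ← mul_assoc, ih]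

theorem evalPath_mul_evalPath_of_ne {a b c d : V} (p : Quiver.Path a b) (q : Quiver.Path c d)
    (hcb : c ≠ b) : evalPath f v p * evalPath f v q = 0 := by
  rw [← h.evalPath_mul_right p, ← h.mul_evalPath_left q, mul_assoc, ← mul_assoc (f b),
    h.ortho b c hcb.symm, zero_mul, mul_zero]

end

/-- The algebra homomorphism on the path algebra given by the values at vertices and arrows. -/
noncomputable def hom (h : IsRepresentation f v) : PathAlgebra k V →ₙₐ[k] B :=
  lift (fun p => evalPath f v p.path) (fun _ _ _ p q => h.evalPath_comp p q)
    (fun _ _ _ _ p q hcb => h.evalPath_mul_evalPath_of_ne p q hcb)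

theorem hom_ofPath (h : IsRepresentation f v) {a b : V} (p : Quiver.Path a b) :
    h.hom (ofPath k p) = evalPath f v p :=
  lift_ofPath _ _ _ p

end IsRepresentation

end Eval

end PathAlgebra

open PathAlgebra

/-! ### Presentations as surjections from a path algebra -/

section

variable {k : Type v} {Λ : Type u} [Field k] [NonUnitalRing Λ] [Module k Λ]

/-- Only the ideal generated by `ρ` matters, so the whole kernel can serve as `ρ`; it is non-empty
because it contains `0`. -/
theorem isPathAlgebraWithRelations_iff : IsPathAlgebraWithRelations k Λ ↔
    ∃ (V : Type u) (_ : Nonempty V) (_ : Quiver.{u} V) (Φ : PathAlgebra k V →ₙₐ[k] Λ),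
      Function.Surjective Φ ∧
      (∃ t : ℕ, 1 ≤ t ∧ ∀ x ∈ (arrowIdeal k V).pow t, Φ x = 0) ∧
      ∀ x, Φ x = 0 → x ∈ (arrowIdeal k V).pow 2 := by
  constructor
  · rintro ⟨V, hV, hQ, ρ, -, ⟨t, ht, hρt⟩, hρ2, h⟩
    obtain ⟨Φ, hΦ, hΦρ⟩ := (algIsomorphic_quotient_iff _).1 h
    exact ⟨V, hV, hQ, Φ, hΦ, ⟨t, ht, fun x hx => (hΦρ x).2 (hρt hx)⟩,
      fun x hx => hρ2 ((hΦρ x).1 hx)⟩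
  · rintro ⟨V, hV, hQ, Φ, hΦ, ⟨t, ht, hΦt⟩, hΦ2⟩
    have key : ∀ x, Φ x = 0 ↔ x ∈ (AlgIdeal.span {x | Φ x = 0} : AlgIdeal k _).toSubmodule :=
      fun x => ⟨fun hx => AlgIdeal.subset_span _ hx,
        fun hx => AlgIdeal.span_le (I := AlgIdeal.ker Φ) subset_rfl hx⟩
    exact ⟨V, hV, hQ, {x | Φ x = 0}, ⟨0, map_zero Φ⟩, ⟨t, ht, fun x hx => (key x).1 (hΦt x hx)⟩,
      fun x hx => hΦ2 x ((key x).2 hx), (algIsomorphic_quotient_iff _).2 ⟨Φ, hΦ, key⟩⟩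

/-! ### From a path algebra with relations to the radical conditions -/

section OfPathAlgebra

variable {V : Type u} [Quiver.{u} V]

theorem isCompleteOrthogonalSet_of_surjective {Φ : PathAlgebra k V →ₙₐ[k] Λ}
    (hΦ : Function.Surjective Φ) (h0 : ∀ x, Φ x = 0 → vertexProj k V x = 0) :
    IsCompleteOrthogonalSet fun a : V => Φ (ofPath k (Quiver.Path.nil : Quiver.Path a a)) where
  idem a := by rw [← map_mul, ofPath_mul_ofPath]; rfl
  ortho a b h := by rw [← map_mul, ofPath_mul_ofPath_of_ne _ _ h.symm, map_zero]
  ne_zero a h := by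
    have := h0 _ h
    rw [vertexProj_nil] at this
    exact one_ne_zero (Finsupp.single_eq_zero.1 this)
  complete y := by
    classical
    obtain ⟨x, rfl⟩ := hΦ y
    -- Asking for all larger `F` makes the claim additive: for a sum, take the union of the two
    -- finite sets.
    suffices h : ∃ F₀ : Finset V, ∀ F : Finset V, F₀ ⊆ F →
        (∑ a ∈ F, ofPath k (Quiver.Path.nil : Quiver.Path a a)) * x = x ∧
        x * (∑ a ∈ F, ofPath k (Quiver.Path.nil : Quiver.Path a a)) = x by
      obtain ⟨F, hF⟩ := h
      obtain ⟨h1, h2⟩ := hF F subset_rfl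
      refine ⟨F, ?_, ?_⟩
      · rw [← map_sum, ← map_mul, h1]
      · rw [← map_sum, ← map_mul, h2]
    induction x using induction_on with
    | zero => exact ⟨∅, by simp⟩
    | add x x' hx hx' =>
      obtain ⟨F, hF⟩ := hx
      obtain ⟨F', hF'⟩ := hx'
      refine ⟨F ∪ F', fun G hG => ?_⟩
      obtain ⟨h1, h2⟩ := hF G (Finset.union_subset_left hG)
      obtain ⟨h1', h2'⟩ := hF' G (Finset.union_subset_right hG)
      rw [mul_add, add_mul, h1, h2, h1', h2']
      exact ⟨rfl, rfl⟩
    | single c a b p =>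
      refine ⟨{a, b}, fun G hG => ?_⟩
      rw [mul_smul_comm, smul_mul_assoc, Finset.sum_mul, Finset.mul_sum,
        Finset.sum_eq_single_of_mem a (hG (by simp)), Finset.sum_eq_single_of_mem b (hG (by simp)),
        ofPath_mul_ofPath, ofPath_mul_ofPath, Quiver.Path.nil_comp, Quiver.Path.comp_nil]
      · exact ⟨rfl, rfl⟩
      · exact fun i _ hi => ofPath_mul_ofPath_of_ne _ _ hi
      · exact fun i _ hi => ofPath_mul_ofPath_of_ne _ _ hi.symm

variable [IsScalarTower k Λ Λ] [SMulCommClass k Λ Λ]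

theorem generalizedElementary_of_surjective [Nonempty V] {Φ : PathAlgebra k V →ₙₐ[k] Λ}
    (hΦ : Function.Surjective Φ)
    (ht : ∃ t : ℕ, 1 ≤ t ∧ ∀ x ∈ (arrowIdeal k V).pow t, Φ x = 0)
    (h2 : ∀ x, Φ x = 0 → x ∈ (arrowIdeal k V).pow 2) :
    IsGeneralizedElementary k Λ ∧ CanBeLifted k Λ ∧ (jacobsonRadical k Λ).IsNilpotent ∧
      HasCompleteOrthogonalSet Λ := by
  have h0 : ∀ x, Φ x = 0 → vertexProj k V x = 0 := fun x hx =>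
    mem_arrowIdeal_iff.1 ((arrowIdeal k V).pow_two_le (h2 x hx))
  have he := isCompleteOrthogonalSet_of_surjective hΦ h0
  obtain ⟨π, hπ⟩ := Φ.exists_factor hΦ (vertexProj k V) h0
  -- The vertices give a multiplicative section of `π`, whose range is the complement of the
  -- radical.
  let s : (V →₀ k) →ₙₐ[k] Λ := idempotentHom _ he.idem he.ortho
  have hs : ∀ c, π (s c) = c := by
    intro c
    induction c using Finsupp.induction_linear with
    | zero => rw [map_zero, map_zero]
    | add x y hx hy => rw [map_add, map_add, hx, hy]
    | single i c =>
      rw [idempotentHom_apply, Finsupp.linearCombination_single, map_smul, hπ, vertexProj_nil,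
        Finsupp.smul_single, smul_eq_mul, mul_one]
  have hsurj : Function.Surjective π := fun c => ⟨s c, hs c⟩
  have hnil : (AlgIdeal.ker π).IsNilpotent := by
    obtain ⟨t, ht1, ht⟩ := ht
    obtain ⟨n, rfl⟩ := Nat.exists_eq_add_of_le' ht1
    refine ⟨n + 1, ht1, (Submodule.eq_bot_iff _).2 fun y hy => ?_⟩
    have hJ : ∀ y ∈ (AlgIdeal.ker π).toSubmodule,
        ∃ x ∈ (arrowIdeal k V).toSubmodule, Φ x = y := by
      intro y hy
      obtain ⟨x, rfl⟩ := hΦ y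
      rw [AlgIdeal.mem_ker, hπ] at hy
      exact ⟨x, mem_arrowIdeal_iff.2 hy, rfl⟩
    obtain ⟨x, hx, rfl⟩ := AlgIdeal.exists_mem_pow_of_mem_pow Φ hJ n y hy
    exact ht x hx
  have hmem : ∀ {x}, x ∈ (jacobsonRadical k Λ).toSubmodule ↔ π x = 0 :=
    mem_jacobsonRadical_iff_of_isNilpotent_ker hsurj hnil
  refine ⟨⟨V, inferInstance, algIsomorphic_of_quotient _ π hsurj fun x => hmem.symm⟩,
    ⟨NonUnitalAlgHom.range s, ?_⟩, ?_, ⟨V, inferInstance, _, he⟩⟩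
  · constructor
    · rw [Submodule.disjoint_def]
      rintro _ ⟨c, rfl⟩ hc
      have hc : π (s c) = 0 := hmem.1 hc
      rw [hs] at hc
      rw [hc]
      exact map_zero s
    · rw [codisjoint_iff, Submodule.eq_top_iff']
      intro x
      rw [← add_sub_cancel (s (π x)) x]
      refine Submodule.add_mem_sup ⟨π x, rfl⟩ (hmem.2 ?_)
      rw [map_sub, hs, sub_self]
  · rw [jacobsonRadical_eq_ker_of_isNilpotent hsurj hnil]
    exact hnil

end OfPathAlgebra

/-! ### From the radical conditions to a quiver with relations -/

section ToPathAlgebra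

/-- A submodule `R` has a linearly independent family that is a basis of `R` modulo `W`. -/
theorem Submodule.exists_linearIndependent_modulo {M : Type u} [AddCommGroup M] [Module k M]
    (R W : Submodule k M) : ∃ (ι : Type u) (v : ι → M), (∀ i, v i ∈ R) ∧ LinearIndependent k v ∧
      Disjoint (Submodule.span k (Set.range v)) W ∧
      R ≤ Submodule.span k (Set.range v) ⊔ W := by
  -- The complement of `R ∩ W` is taken inside `R`, so that the family stays in `R`.
  obtain ⟨C, hC⟩ := (W.comap R.subtype).exists_isCompl
  let b := Module.Basis.ofVectorSpace k C
  have hspan : Submodule.span k (Set.range fun i => ((b i : R) : M)) = C.map R.subtype := by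
    rw [show (fun i => ((b i : R) : M)) = (R.subtype ∘ₗ C.subtype) ∘ b from rfl, Set.range_comp,
      Submodule.span_image, b.span_eq, Submodule.map_top, LinearMap.range_comp,
      Submodule.range_subtype]
  refine ⟨_, fun i => ((b i : R) : M), fun i => (b i : R).2, ?_, ?_, ?_⟩
  · exact b.linearIndependent.map' (R.subtype ∘ₗ C.subtype)
      (LinearMap.ker_eq_bot.2 (R.injective_subtype.comp C.injective_subtype))
  · rw [hspan, Submodule.disjoint_def]
    rintro _ ⟨x, hx, rfl⟩ hW
    rw [Submodule.disjoint_def.1 hC.disjoint x hW hx, map_zero]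
  · rw [hspan]
    intro x hx
    have : (⟨x, hx⟩ : R) ∈ C ⊔ W.comap R.subtype := by
      rw [hC.symm.sup_eq_top]
      trivial
    obtain ⟨c, hc, w, hw, h⟩ := Submodule.mem_sup.1 this
    rw [show x = (c : M) + w from congrArg Subtype.val h.symm]
    exact Submodule.add_mem_sup ⟨c, hc, rfl⟩ hw

variable {V : Type u} {N : AlgIdeal k Λ} {π : Λ →ₙₐ[k] (V →₀ k)} {f : V → Λ}

/-- `Finsupp.linearCombination k f` is a linear section of `π`. -/
theorem sub_linearCombination_mem (hN : ∀ x, π x = 0 ↔ x ∈ N.toSubmodule)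
    (hf : ∀ i, π (f i) = Finsupp.single i 1) (x : Λ) :
    x - Finsupp.linearCombination k f (π x) ∈ N.toSubmodule := by
  have hs : ∀ c, π (Finsupp.linearCombination k f c) = c := by
    intro c
    induction c using Finsupp.induction_linear with
    | zero => rw [map_zero, map_zero]
    | add x y hx hy => rw [map_add, map_add, hx, hy]
    | single i c =>
      rw [Finsupp.linearCombination_single, map_smul, hf, Finsupp.smul_single, smul_eq_mul,
        mul_one]
  rw [← hN, map_sub, hs, sub_self]

/-- Since `N` is the kernel of `π`, its preimage is the ideal `ker (π.comp Φ)`, and it is enough to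
test generators. -/
theorem map_mem_of_mem_arrowIdeal [Quiver.{u} V] {Φ : PathAlgebra k V →ₙₐ[k] Λ}
    (hΦ : ∀ {a b : V} (α : a ⟶ b), Φ (ofPath k α.toPath) ∈ N.toSubmodule)
    (hN : ∀ x, π x = 0 ↔ x ∈ N.toSubmodule) :
    ∀ x ∈ (arrowIdeal k V).toSubmodule, Φ x ∈ N.toSubmodule := by
  intro x hx
  rw [← hN]
  refine (AlgIdeal.mem_ker (π.comp Φ)).1 (AlgIdeal.span_le ?_ hx)
  rintro _ ⟨a, b, α, rfl⟩
  exact (hN _).2 (hΦ α)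

variable [IsScalarTower k Λ Λ] [SMulCommClass k Λ Λ]

/-- A lifting of `Λ / r(Λ)` to a subalgebra lifts the primitive idempotents of `Λ / r(Λ)` to
pairwise orthogonal idempotents of `Λ`. -/
theorem exists_orthogonal_idempotents (hE : IsGeneralizedElementary k Λ) (hL : CanBeLifted k Λ) :
    ∃ (V : Type u) (_ : Nonempty V) (π : Λ →ₙₐ[k] (V →₀ k)) (f : V → Λ),
      (∀ x, π x = 0 ↔ x ∈ (jacobsonRadical k Λ).toSubmodule) ∧
      (∀ i, π (f i) = Finsupp.single i 1) ∧ (∀ i, f i * f i = f i) ∧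
      ∀ i j, i ≠ j → f i * f j = 0 := by
  obtain ⟨V, hV, φ, hφ⟩ := hE
  obtain ⟨A, hA⟩ := hL
  let π := φ.comp (jacobsonRadical k Λ).projHom
  have hπ : ∀ x, π x = 0 ↔ x ∈ (jacobsonRadical k Λ).toSubmodule := by
    intro x
    rw [← AlgIdeal.projHom_eq_zero, NonUnitalAlgHom.comp_apply]
    exact ⟨fun h => hφ.1 (h.trans (map_zero φ).symm), fun h => by rw [h, map_zero]⟩
  -- `π` restricts to a bijection from `A` onto `V →₀ k`, so identities between elements of `A` can
  -- be checked after applying `π`.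
  have hinj : ∀ x ∈ A, ∀ y ∈ A, π x = π y → x = y := by
    intro x hx y hy hxy
    rw [← sub_eq_zero]
    refine Submodule.disjoint_def.1 hA.disjoint _ (sub_mem hx hy) ((hπ _).1 ?_)
    rw [map_sub, hxy, sub_self]
  have hsurj : ∀ c, ∃ x ∈ A, π x = c := by
    intro c
    obtain ⟨q, rfl⟩ := hφ.2 c
    obtain ⟨x, rfl⟩ := (jacobsonRadical k Λ).projHom_surjective q
    have hx : x ∈ A.toSubmodule ⊔ (jacobsonRadical k Λ).toSubmodule := by
      rw [hA.sup_eq_top]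
      trivial
    obtain ⟨a, ha, n, hn, rfl⟩ := Submodule.mem_sup.1 hx
    exact ⟨a, ha, by
      change π a = π (a + n)
      rw [map_add, (hπ n).2 hn, add_zero]⟩
  choose f hfA hf using fun i => hsurj (Finsupp.single i 1)
  refine ⟨V, hV, π, f, hπ, hf, fun i => ?_, fun i j hij => ?_⟩
  · apply hinj _ (mul_mem (hfA i) (hfA i)) _ (hfA i)
    rw [map_mul, hf, ← Finsupp.single_mul, mul_one]
  · apply hinj _ (mul_mem (hfA i) (hfA j)) _ (zero_mem A)
    rw [map_mul, hf, hf, map_zero]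
    classical
    ext l
    rw [Finsupp.mul_apply, Finsupp.single_apply, Finsupp.single_apply, Finsupp.zero_apply]
    split_ifs with h1 h2
    · exact absurd (h1.trans h2.symm) hij
    all_goals simp

/-- In the presence of local units, an ideal with quotient `⊕ k` is generated modulo its square by
its Peirce components. -/
theorem mem_of_peirce_mem (hN : ∀ x, π x = 0 ↔ x ∈ N.toSubmodule)
    (hf : ∀ i, π (f i) = Finsupp.single i 1) {x e e' : Λ} (hx : x ∈ N.toSubmodule)
    (hex : e * x = x) (hxe : x * e' = x) {T : Submodule k Λ} (hT : N.pow 2 ≤ T)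
    (hfT : ∀ a b, f a * x * f b ∈ T) : x ∈ T := by
  have key : ∀ c d : V →₀ k, Finsupp.linearCombination k f c * x *
      Finsupp.linearCombination k f d ∈ T := by
    intro c d
    induction c using Finsupp.induction_linear with
    | zero => rw [map_zero, zero_mul, zero_mul]; exact zero_mem _
    | add c c' hc hc' => rw [map_add, add_mul, add_mul]; exact add_mem hc hc'
    | single i c =>
      induction d using Finsupp.induction_linear with
      | zero => rw [map_zero, mul_zero]; exact zero_mem _
      | add d d' hd hd' => rw [map_add, mul_add]; exact add_mem hd hd'
      | single j d =>
        rw [Finsupp.linearCombination_single, Finsupp.linearCombination_single, smul_mul_assoc,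
          smul_mul_smul_comm]
        exact T.smul_mem _ (hfT i j)
  have h1 := sub_linearCombination_mem hN hf e
  have h2 := sub_linearCombination_mem hN hf e'
  -- The `f`-combinations replace the local units `e` and `e'` up to elements of `N`; each
  -- correction term is thus a product of two elements of `N`.
  have hx' : x = Finsupp.linearCombination k f (π e) * x * Finsupp.linearCombination k f (π e') +
      Finsupp.linearCombination k f (π e) * x * (e' - Finsupp.linearCombination k f (π e')) +
      (e - Finsupp.linearCombination k f (π e)) * x := by
    rw [← mul_add, add_sub_cancel, mul_assoc, hxe, ← add_mul, add_sub_cancel, hex]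
  rw [hx']
  exact add_mem (add_mem (key _ _)
    (hT (N.mul_mem_pow_two (N.mul_mem_left _ _ hx) h2))) (hT (N.mul_mem_pow_two h1 hx))

variable [Quiver.{u} V] {v : ∀ {a b : V}, (a ⟶ b) → Λ}

/-- Multiplying out `hgen` gives N^n ⊆ S + N^(n+1) for all n ≥ 1, where S is the image. Since S
contains the `f i`, it spans Λ modulo N, hence modulo every power of N, the last of which is zero.
-/
theorem hom_surjective (hN : ∀ x, π x = 0 ↔ x ∈ N.toSubmodule)
    (hf : ∀ i, π (f i) = Finsupp.single i 1) (hnil : N.IsNilpotent)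
    (hv : IsRepresentation f v)
    (hgen : N.toSubmodule ≤ (NonUnitalAlgHom.range (hv.hom (k := k))).toSubmodule ⊔ N.pow 2) :
    Function.Surjective (hv.hom (k := k)) := by
  set S := (NonUnitalAlgHom.range (hv.hom (k := k))).toSubmodule with hS
  have hmul : ∀ x ∈ S, ∀ y ∈ S, x * y ∈ S := by
    rintro _ ⟨x, rfl⟩ _ ⟨y, rfl⟩
    exact ⟨x * y, map_mul (hv.hom (k := k)) x y⟩
  have hpow : ∀ n, N.pow (n + 1) ≤ S ⊔ N.pow (n + 2) := by
    intro n
    induction n with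
    | zero => simpa only [zero_add, AlgIdeal.pow_one] using hgen
    | succ n ih =>
      rw [AlgIdeal.pow_add_two, Submodule.span_le]
      rintro _ ⟨x, hx, y, hy, rfl⟩
      obtain ⟨s, hs, x', hx', rfl⟩ := Submodule.mem_sup.1 (ih hx)
      obtain ⟨s', hs', y', hy', rfl⟩ := Submodule.mem_sup.1 (hgen hy)
      -- Needed for the cross term: with `s` in `N.pow (n + 1)` and `y'` in `N.pow 2`, `s * y'` lies
      -- in `N.pow (n + 3)`.
      have hsN : s ∈ N.pow (n + 1) := by
        have := sub_mem hx (N.pow_add_two_le n hx')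
        rwa [add_sub_cancel_right] at this
      have h : (s + x') * (s' + y') = s * s' + (s * y' + x' * (s' + y')) := by noncomm_ring
      rw [h]
      exact Submodule.add_mem_sup (hmul s hs s' hs')
        (add_mem (N.pow_mul_pow_mem hsN 1 y' hy') (N.mul_mem_pow_add_two hx' hy))
  have htop : ∀ n, (⊤ : Submodule k Λ) ≤ S ⊔ N.pow (n + 1) := by
    intro n
    induction n with
    | zero =>
      intro x _
      rw [← add_sub_cancel (Finsupp.linearCombination k f (π x)) x, zero_add, AlgIdeal.pow_one]
      refine Submodule.add_mem_sup ?_ (sub_linearCombination_mem hN hf x)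
      rw [Finsupp.linearCombination_apply]
      refine Submodule.sum_mem _ fun i _ => S.smul_mem _ ?_
      exact ⟨ofPath k (Quiver.Path.nil : Quiver.Path i i), hv.hom_ofPath _⟩
    | succ n ih => exact ih.trans (sup_le le_sup_left (hpow n))
  obtain ⟨t, ht, h⟩ := hnil
  obtain ⟨n, rfl⟩ := Nat.exists_eq_add_of_le' ht
  intro x
  have hx := htop n (Submodule.mem_top (x := x))
  rw [h, sup_bot_eq] at hx
  exact hx

/-- The Peirce components of the image of an element of the path algebra, modulo `N ^ 2`. -/
theorem peirce_hom_sub_mem (hv : IsRepresentation f v)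
    (hJ : ∀ x ∈ (arrowIdeal k V).toSubmodule, hv.hom x ∈ N.toSubmodule)
    (a b : V) (x : PathAlgebra k V) :
    f a * (hv.hom x - Finsupp.linearCombination k f (vertexProj k V x)) * f b -
      Finsupp.linearCombination k (v (a := a) (b := b)) (arrowCoeff a b x) ∈ N.pow 2 := by
  -- On single paths: vertices cancel against the subtracted combination, paths of length at least 2
  -- land in N^2, and orthogonality kills every arrow not going from `a` to `b`.
  induction x using induction_on with
  | zero => simp
  | add x y hx hy =>
    simp only [map_add]
    convert add_mem hx hy using 1
    noncomm_ring
  | single c i j p =>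
    simp only [map_smul]
    rw [← smul_sub, mul_smul_comm, smul_mul_assoc, ← smul_sub]
    refine Submodule.smul_mem _ _ ?_
    cases p with
    | nil =>
      rw [vertexProj_nil, hv.hom_ofPath, evalPath, Finsupp.linearCombination_single, one_smul,
        sub_self, mul_zero, zero_mul, arrowCoeff_eq_zero, map_zero, sub_zero]
      · exact zero_mem _
      · intro α h
        injection h with h1 h2 h3
        subst h1
        subst h2
        exact Quiver.Path.cons_ne_nil _ _ (eq_of_heq h3)
    | cons p α =>
      rw [vertexProj_cons, map_zero, sub_zero]
      cases p with
      | cons p β =>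
        rw [arrowCoeff_eq_zero, map_zero, sub_zero]
        · have h2 : hv.hom (ofPath k ((p.cons β).cons α)) ∈ N.pow 2 :=
            AlgIdeal.map_mem_pow (hv.hom (k := k)) hJ 1 _ (ofPath_cons_cons_mem_pow_two p β α)
          exact N.mul_mem_pow_right _ 1 _ (N.mul_mem_pow_left _ 1 _ h2)
        · intro γ h
          injection h with h1 h2 h3
          subst h1
          subst h2
          have := congrArg Quiver.Path.length (eq_of_heq h3)
          simp at this
      | nil =>
        change f a * hv.hom (ofPath k α.toPath) * f b - Finsupp.linearCombination k _
          (arrowCoeff a b (ofPath k α.toPath)) ∈ _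
        rw [hv.hom_ofPath, hv.evalPath_toPath]
        by_cases hi : a = i
        · subst hi
          by_cases hj : b = j
          · subst hj
            rw [hv.left, hv.right, arrowCoeff_toPath, Finsupp.linearCombination_single, one_smul,
              sub_self]
            exact zero_mem _
          · rw [arrowCoeff_eq_zero, map_zero, ← hv.right α, mul_assoc, mul_assoc,
              hv.ortho _ _ (Ne.symm hj), mul_zero, mul_zero, sub_zero]
            · exact zero_mem _
            · intro γ h
              injection h with h1 h2 h3
              exact hj h2
        · rw [arrowCoeff_eq_zero, map_zero, ← hv.left α, ← mul_assoc,
            hv.ortho _ _ hi, zero_mul, zero_mul, sub_zero]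
          · exact zero_mem _
          · intro γ h
            injection h with h1 h2 h3
            exact hi h1

/-- Vertex coefficients vanish because `π` composed with `hv.hom` is `vertexProj`. Then
`peirce_hom_sub_mem` puts the combination of the `v α` with the arrow coefficients of `x` into N^2,
so `hdisj` and `hind` make these coefficients zero. -/
theorem mem_pow_two_of_hom_eq_zero (hN : ∀ x, π x = 0 ↔ x ∈ N.toSubmodule)
    (hf : ∀ i, π (f i) = Finsupp.single i 1) (hv : IsRepresentation f v)
    (hJ : ∀ x ∈ (arrowIdeal k V).toSubmodule, hv.hom x ∈ N.toSubmodule)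
    (hind : ∀ a b : V, LinearIndependent k (v (a := a) (b := b)))
    (hdisj : ∀ a b : V, Disjoint (Submodule.span k (Set.range (v (a := a) (b := b)))) (N.pow 2))
    {x : PathAlgebra k V} (hx : hv.hom x = 0) : x ∈ (arrowIdeal k V).pow 2 := by
  have hπ : ∀ x, π (hv.hom x) = vertexProj k V x := by
    intro x
    induction x using induction_on with
    | zero => simp
    | add x y hx hy => rw [map_add, map_add, hx, hy, map_add]
    | single c i j p =>
      rw [map_smul, map_smul, map_smul]
      congr 1
      cases p with
      | nil => rw [hv.hom_ofPath, evalPath, hf, vertexProj_nil]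
      | cons p α =>
        rw [vertexProj_cons, hN]
        exact hJ _ (ofPath_cons_mem_arrowIdeal p α)
  have h0 : vertexProj k V x = 0 := by rw [← hπ, hx, map_zero]
  refine mem_arrowIdeal_pow_two h0 fun a b => ?_
  have h := peirce_hom_sub_mem hv hJ a b x
  rw [hx, h0, map_zero, sub_zero, mul_zero, zero_mul, zero_sub, neg_mem_iff] at h
  refine (linearIndependent_iff.1 (hind a b)) _ (Submodule.disjoint_def.1 (hdisj a b) _ ?_ h)
  rw [← Finsupp.range_linearCombination]
  exact ⟨_, rfl⟩

end ToPathAlgebra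

variable [IsScalarTower k Λ Λ] [SMulCommClass k Λ Λ]

theorem isPathAlgebraWithRelations_of_generalizedElementary (hE : IsGeneralizedElementary k Λ)
    (hL : CanBeLifted k Λ) (hnil : (jacobsonRadical k Λ).IsNilpotent)
    (hC : HasCompleteOrthogonalSet Λ) : IsPathAlgebraWithRelations k Λ := by
  obtain ⟨V, hV, π, f, hN, hf, idem, ortho⟩ := exists_orthogonal_idempotents hE hL
  obtain ⟨I, -, e, he⟩ := hC
  set N := jacobsonRadical k Λ
  -- `R a b` is the Peirce component f_a N f_b.
  let R : V → V → Submodule k Λ := fun a b =>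
    N.toSubmodule.map (LinearMap.mulRight k (f b) ∘ₗ LinearMap.mulLeft k (f a))
  have hR : ∀ {a b x}, x ∈ R a b → x ∈ N.toSubmodule ∧ f a * x = x ∧ x * f b = x := by
    rintro a b _ ⟨x, hx, rfl⟩
    change f a * x * f b ∈ _ ∧ f a * (f a * x * f b) = f a * x * f b ∧
      f a * x * f b * f b = f a * x * f b
    refine ⟨N.mul_mem_right _ _ (N.mul_mem_left _ _ hx), ?_, ?_⟩
    · rw [← mul_assoc, ← mul_assoc, idem]
    · rw [mul_assoc, idem]
  choose B w hwR hind hdisj hgen using fun a b =>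
    Submodule.exists_linearIndependent_modulo (R a b) (N.pow 2)
  -- The arrows from `a` to `b` index a basis of `R a b` modulo N^2.
  let : Quiver.{u} V := ⟨B⟩
  let v : ∀ {a b : V}, (a ⟶ b) → Λ := fun {a b} α => w a b α
  have hv : IsRepresentation f v :=
    ⟨idem, ortho, fun α => (hR (hwR _ _ α)).2.1, fun α => (hR (hwR _ _ α)).2.2⟩
  have hvN : ∀ {a b : V} (α : a ⟶ b), v α ∈ N.toSubmodule := fun α => (hR (hwR _ _ α)).1
  have hJ : ∀ x ∈ (arrowIdeal k V).toSubmodule, hv.hom x ∈ N.toSubmodule := by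
    refine map_mem_of_mem_arrowIdeal (fun α => ?_) hN
    rw [hv.hom_ofPath, hv.evalPath_toPath]
    exact hvN α
  refine isPathAlgebraWithRelations_iff.2 ⟨V, hV, inferInstance, hv.hom,
    hom_surjective hN hf hnil hv ?_, ?_,
    fun x hx => mem_pow_two_of_hom_eq_zero hN hf hv hJ hind hdisj hx⟩
  · intro x hx
    -- The given complete set need not be related to the lifted idempotents `f`; it only supplies a
    -- local unit for `x`.
    obtain ⟨F, h1, h2⟩ := he.complete x
    refine mem_of_peirce_mem hN hf hx h1 h2 le_sup_right fun a b => ?_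
    refine (hgen a b).trans (sup_le_sup_right (Submodule.span_le.2 ?_) _) ⟨x, hx, rfl⟩
    rintro _ ⟨α, rfl⟩
    exact ⟨ofPath k (Quiver.Hom.toPath (a := a) (b := b) α),
      (hv.hom_ofPath _).trans (hv.evalPath_toPath (a := a) (b := b) α)⟩
  · obtain ⟨t, ht, h⟩ := hnil
    obtain ⟨n, rfl⟩ := Nat.exists_eq_add_of_le' ht
    refine ⟨n + 1, ht, fun x hx => ?_⟩
    have := AlgIdeal.map_mem_pow _ hJ n x hx
    rwa [h, Submodule.mem_bot] at this

end

theorem corollary3p14 (k : Type v) (Λ : Type u) [Field k] [NonUnitalRing Λ] [Module k Λ]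
    [IsScalarTower k Λ Λ] [SMulCommClass k Λ Λ] :
    (IsGeneralizedElementary k Λ ∧ CanBeLifted k Λ ∧ (jacobsonRadical k Λ).IsNilpotent ∧
      HasCompleteOrthogonalSet Λ) ↔
    IsPathAlgebraWithRelations k Λ := by
  constructor
  · rintro ⟨hE, hL, hnil, hC⟩
    exact isPathAlgebraWithRelations_of_generalizedElementary hE hL hnil hC
  · intro h
    obtain ⟨V, hV, hQ, Φ, hΦ, ht, h2⟩ := isPathAlgebraWithRelations_iff.1 h
    exact generalizedElementary_of_surjective hΦ ht h2
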